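/- Let $\Sigma=\{a,b\}$ be a binary alphabet. A finite word $w\in\Sigma^*$ is \emph{closed} if it is empty or has a factor $v\neq w$ that occurs in $w$ exactly twice, once as a prefix and once as a suffix (with no internal occurrence); otherwise $w$ is \emph{open}. The \emph{oc-sequence} of $w\in\Sigma^*$ is the binary word $\mathrm{oc}(w)=c(1)c(2)\cdots c(|w|)$, where $c(n)=1$ if the prefix of $w$ of length $n$ is closed and $c(n)=0$ if it is open. Write $u\sim v$ if $v$ is obtained from $u$ by a permutation of the letters of $\Sigma$, and let $\mathrm{Fact}(u)$ denote the set of factors (blocks of consecutive letters, including the empty word and $u$ itself) of $u$. Let \[ \mathcal C=\{A\subseteq\Sigma^* \mid (\forall u\in A,\ \mathrm{Fact}(u)\subseteq A)\ \text{ and }\ (\forall u,v\in A,\ \mathrm{oc}(u)=\mathrm{oc}(v)\Rightarrow u\sim v)\}. \] An infinite word over $\Sigma$ is \emph{Sturmian} if it has exactly $n+1$ distinct factors of length $n$ for every $n\ge 0$; let $St\subseteq\Sigma^*$ be the set of finite Sturmian words, that is, of all finite factors of infinite Sturmian words. Then $St$ is a maximal element of $\mathcal C$ with respect to inclusion: $St\in\mathcal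 C$, and no $A\in\mathcal C$ properly contains $St$. -/

import Mathlib

namespace OCWords

/-- A finite word is closed if it is empty or has a factor `v ≠ w` occurring as a prefix and as a
suffix of `w` and having no internal occurrence (an occurrence `w = p v s` is internal if both
`p` and `s` are nonempty). -/
def IsClosedWord {α : Type*} (w : List α) : Prop :=
  w = [] ∨ ∃ v : List α, v ≠ w ∧ v <+: w ∧ v <:+ w ∧
    ∀ p s : List α, w = p ++ v ++ s → p = [] ∨ s = []

open Classical in
/-- The oc-sequence of a finite word `w`: a word of the same length as `w`, whose entry number
`n` (for `1 ≤ n ≤ |w|`, here `n = i + 1`) is `1` if the prefix of `w` of length `n` is closed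
and `0` if it is open. -/
noncomputable def oc {α : Type*} (w : List α) : List (Fin 2) :=
  (List.range w.length).map fun i => if IsClosedWord (w.take (i + 1)) then 1 else 0

/-- Two words are isomorphic if one is obtained from the other by renaming letters. -/
def Isomorphic {α : Type*} (u v : List α) : Prop :=
  ∃ σ : Equiv.Perm α, v = u.map σ

/-- The set of finite factors of an infinite word. -/
def factors {α : Type*} (x : ℕ → α) : Set (List α) :=
  {u | ∃ i : ℕ, u = List.ofFn fun j : Fin u.length => x (i + j)}

/-- An infinite binary word is Sturmian if it has exactly `n + 1` distinct factors of length `n`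
for every `n ≥ 0`. The binary alphabet is `Bool`. -/
def IsSturmian (x : ℕ → Bool) : Prop :=
  ∀ n : ℕ, {u : List Bool | u ∈ factors x ∧ u.length = n}.ncard = n + 1

/-- The set of finite Sturmian words, i.e. of finite factors of infinite Sturmian words. -/
def St : Set (List Bool) :=
  {u | ∃ x : ℕ → Bool, IsSturmian x ∧ u ∈ factors x}

/-- The class of factorial binary languages whose words are determined by their oc-sequences up
to isomorphism. -/
def ClassC : Set (Set (List Bool)) :=
  {A | (∀ u ∈ A, ∀ v : List Bool, v <:+: u → v ∈ A) ∧
    ∀ u ∈ A, ∀ v ∈ A, oc u = oc v → Isomorphic u v}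

end OCWords

/-! Everything rests on the classical description of finite Sturmian words as the balanced ones
(`mem_St_iff`), that is, those without a pair of factors `c t c` and `d t d` with `c ≠ d`. An
infinite Sturmian word has exactly one right special factor of each length, and a pair `c t c`, `d t
d` would force it to be eventually periodic. Conversely, a balanced word admits an irrational slope
and is a prefix of a mechanical word of that slope.

`St` is in the class: after a renaming, two words with the same oc-sequence share their first
letter. At a first later difference, two balanced words extend the same nonempty word by different
letters, and then exactly one extension is closed (`prefixClosed_not_iff`): never both, for any
words, and at least one by balance. So the oc-sequences would differ there.

Maximality: a shortest word `w` of a larger language outside `St` is minimal unbalanced, with prefix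
`c t c` and suffix `d t d`, `t` a palindrome. It is open. The balanced word that differs from `w`
only in the last letter is open as well, so both have the same oc-sequence. Sharing the first letter
but not the last, they are not isomorphic. -/

namespace OCWords

/-! ### Conflicts and letter counts -/

/-- Inside the first `N` letters of `w`, the word `c t c` occurs at `i` and the word `d t d` at `j`,
where `d` is the letter other than `c` and `t` has length `m`. -/
def Conflict (w : ℕ → Bool) (N : ℕ) (c : Bool) (i j m : ℕ) : Prop :=
  i + m + 1 < N ∧ j + m + 1 < N ∧ w i = c ∧ w j = !c ∧ w (i + m + 1) = c ∧ w (j + m + 1) = !c ∧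
    ∀ k < m, w (i + 1 + k) = w (j + 1 + k)

/-- The prefix of length `N` of `w` is balanced. -/
def Balanced (w : ℕ → Bool) (N : ℕ) : Prop :=
  ∀ c i j m, ¬ Conflict w N c i j m

/-- The number of letters `true` among the first `k` letters of `w`. -/
def count (w : ℕ → Bool) (k : ℕ) : ℤ :=
  ∑ l ∈ Finset.range k, if w l then 1 else 0

theorem count_succ (w : ℕ → Bool) (k : ℕ) :
    count w (k + 1) = count w k + if w k then 1 else 0 :=
  Finset.sum_range_succ _ _

theorem Conflict.symm {w : ℕ → Bool} {N : ℕ} {c : Bool} {i j m : ℕ} (h : Conflict w N c i j m) :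
    Conflict w N (!c) j i m := by
  obtain ⟨h1, h2, h3, h4, h5, h6, h7⟩ := h
  exact ⟨h2, h1, h4, by simpa using h3, h6, by simpa using h5, fun k hk => (h7 k hk).symm⟩

theorem Conflict.count_eq {w : ℕ → Bool} {N i j m : ℕ} (h : Conflict w N false i j m) :
    count w (j + m + 2) - count w j = count w (i + m + 2) - count w i + 2 := by
  obtain ⟨-, -, h3, h4, h5, h6, h7⟩ := h
  have key : ∀ k ≤ m, count w (j + 1 + k) - count w (j + 1) =
      count w (i + 1 + k) - count w (i + 1) := by
    intro k
    induction k with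
    | zero => simp
    | succ k ih =>
      intro hk
      have := ih (by omega)
      have e1 := count_succ w (j + 1 + k)
      have e2 := count_succ w (i + 1 + k)
      rw [h7 k (by omega)] at e2
      rw [← add_assoc, ← add_assoc]
      omega
  have := key m le_rfl
  have e1 := count_succ w j
  have e2 := count_succ w i
  have e3 := count_succ w (j + m + 1)
  have e4 := count_succ w (i + m + 1)
  rw [show j + 1 + m = j + m + 1 by ring, show i + 1 + m = i + m + 1 by ring] at this
  simp [h3, h4, h5, h6] at e1 e2 e3 e4
  rw [show j + m + 1 + 1 = j + m + 2 by ring] at e3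
  rw [show i + m + 1 + 1 = i + m + 2 by ring] at e4
  omega

/-- The difference of the two running counts moves by at most 1 per step. Between its last value `≤
0` and its first value `2` it is constantly 1: there the windows agree, and at both ends of this
stretch they read `false` against `true`. -/
theorem exists_conflict_of_count {w : ℕ → Bool} {N i j n : ℕ} (hi : i + n ≤ N) (hj : j + n ≤ N)
    (h : count w (i + n) - count w i + 2 ≤ count w (j + n) - count w j) :
    ∃ i' j' m, m + 2 ≤ n ∧ Conflict w N false i' j' m := by
  classical
  let D : ℕ → ℤ := fun k => count w (j + k) - count w j - (count w (i + k) - count w i)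
  have hD0 : D 0 = 0 := by simp [D]
  have hDs : ∀ k, D (k + 1) =
      D k + (if w (j + k) then 1 else 0) - (if w (i + k) then 1 else 0) := by
    intro k
    have e1 := count_succ w (j + k)
    have e2 := count_succ w (i + k)
    simp only [D, ← add_assoc]
    omega
  have hex : ∃ k, 2 ≤ D k := ⟨n, by simp only [D]; omega⟩
  obtain ⟨k₂, hk₂, hmin⟩ : ∃ k, 2 ≤ D k ∧ ∀ l < k, D l < 2 :=
    ⟨Nat.find hex, Nat.find_spec hex, fun l hl => by simpa using Nat.find_min hex hl⟩
  have hk₂n : k₂ ≤ n := by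
    by_contra hlt
    have := hmin n (by omega)
    simp only [D] at this
    omega
  obtain ⟨k₁, hk₁, hk₁₂, hmax⟩ : ∃ k, D k ≤ 0 ∧ k ≤ k₂ ∧ ∀ l, k < l → l ≤ k₂ → 0 < D l :=
    ⟨Nat.findGreatest (fun k => D k ≤ 0) k₂,
      Nat.findGreatest_spec (P := fun k => D k ≤ 0) (Nat.zero_le k₂) hD0.le,
      Nat.findGreatest_le k₂, fun l hl hl' => by
        simpa using Nat.findGreatest_is_greatest (P := fun k => D k ≤ 0) hl hl'⟩
  have hone : ∀ l, k₁ < l → l < k₂ → D l = 1 := fun l h1 h2 => by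
    have := hmax l h1 h2.le
    have := hmin l h2
    omega
  have s1 := hDs k₁
  have hne : k₁ ≠ k₂ := by rintro rfl; omega
  have hp := hmax (k₁ + 1) (by omega) (by omega)
  have hne' : k₁ + 1 ≠ k₂ := by rintro rfl; split_ifs at s1 <;> omega
  obtain ⟨m, rfl⟩ : ∃ m, k₂ = k₁ + m + 2 := ⟨k₂ - k₁ - 2, by omega⟩
  have s2 := hDs (k₁ + m + 1)
  have o2 := hone (k₁ + m + 1) (by omega) (by omega)
  rw [show k₁ + m + 1 + 1 = k₁ + m + 2 by ring] at s2
  refine ⟨i + k₁, j + k₁, m, by omega, by omega, by omega, ?_, ?_, ?_, ?_, ?_⟩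
  · by_contra hc; split_ifs at s1 <;> first | omega | simp_all
  · by_contra hc; split_ifs at s1 <;> first | omega | simp_all
  · rw [show i + k₁ + m + 1 = i + (k₁ + m + 1) by ring]
    by_contra hc; split_ifs at s2 <;> first | omega | simp_all
  · rw [show j + k₁ + m + 1 = j + (k₁ + m + 1) by ring]
    by_contra hc; split_ifs at s2 <;> first | omega | simp_all
  · intro k hk
    have s3 := hDs (k₁ + 1 + k)
    rw [hone (k₁ + 1 + k) (by omega) (by omega),
      hone (k₁ + 1 + k + 1) (by omega) (by omega)] at s3
    rw [show i + k₁ + 1 + k = i + (k₁ + 1 + k) by ring,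
      show j + k₁ + 1 + k = j + (k₁ + 1 + k) by ring]
    cases hA : w (i + (k₁ + 1 + k)) <;> cases hB : w (j + (k₁ + 1 + k)) <;> simp [hA, hB] at s3 ⊢

theorem count_eq_of_reverse {w : ℕ → Bool} {i j n : ℕ}
    (h : ∀ k < n, w (i + k) = w (j + (n - 1 - k))) :
    count w (i + n) - count w i = count w (j + n) - count w j := by
  have e : ∀ i, count w (i + n) - count w i = ∑ k ∈ Finset.range n, if w (i + k) then 1 else 0 := by
    intro i
    rw [count, Finset.sum_range_add, count, add_sub_cancel_left]
  rw [e, e, ← Finset.sum_range_reflect]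
  refine Finset.sum_congr rfl fun k hk => ?_
  have hk := Finset.mem_range.1 hk
  rw [h _ (by omega), show n - 1 - (n - 1 - k) = k by omega]

/-- A conflict with shortest middle word has a palindromic middle word. -/
theorem Conflict.exists_palindrome {w : ℕ → Bool} {N : ℕ} {c : Bool} {i j m : ℕ}
    (h : Conflict w N c i j m) :
    ∃ i j m, Conflict w N false i j m ∧ ∀ k < m, w (i + 1 + k) = w (i + m - k) := by
  classical
  have hex : ∃ m i j, Conflict w N false i j m := by
    cases c
    · exact ⟨m, i, j, h⟩
    · exact ⟨m, j, i, h.symm⟩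
  obtain ⟨i, j, hc⟩ := Nat.find_spec hex
  have hmin : ∀ m' < Nat.find hex, ∀ i j, ¬ Conflict w N false i j m' := fun m' hm' => by
    simpa using Nat.find_min hex hm'
  set m := Nat.find hex
  refine ⟨i, j, m, hc, ?_⟩
  by_contra hne
  have hex' : ∃ k, k < m ∧ w (i + 1 + k) ≠ w (i + m - k) := by push Not at hne; exact hne
  -- At the first failure `k` of the palindrome property, the first `k` letters of the middle word
  -- are the reversal of its last `k`, so they have equal counts. Bordering them by the mismatched
  -- letter inside and the conflict letter outside gives windows of length `k + 2` whose counts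
  -- differ by 2, hence a conflict with shorter middle word.
  obtain ⟨k, ⟨hk, hkne⟩, hkmin⟩ : ∃ k, (k < m ∧ w (i + 1 + k) ≠ w (i + m - k)) ∧
      ∀ l < k, w (i + 1 + l) = w (i + m - l) :=
    ⟨Nat.find hex', Nat.find_spec hex', fun l hl => by
      by_contra hl'
      exact Nat.find_min hex' hl ⟨lt_trans hl (Nat.find_spec hex').1, hl'⟩⟩
  have hc' := hc
  obtain ⟨h1, h2, h3, h4, h5, h6, h7⟩ := hc
  have hinner : ∀ p q, (∀ l < k, w (p + 1 + l) = w (i + 1 + l)) →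
      (∀ l < k, w (q + 1 + l) = w (i + (m - k) + 1 + l)) →
      count w (p + 1 + k) - count w (p + 1) = count w (q + 1 + k) - count w (q + 1) := by
    intro p q hp hq
    refine count_eq_of_reverse fun l hl => ?_
    rw [hp l hl, hq _ (by omega), hkmin l hl]
    congr 1; omega
  have fin : ∀ p q, p + k + 1 < N → q + k + 1 < N → w p = false → w q = true →
      w (p + 1 + k) = false → w (q + 1 + k) = true →
      count w (p + 1 + k) - count w (p + 1) = count w (q + 1 + k) - count w (q + 1) → False := by
    intro p q hp hq a1 a2 a3 a4 a5
    have e1 := count_succ w p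
    have e2 := count_succ w q
    have e3 := count_succ w (p + 1 + k)
    have e4 := count_succ w (q + 1 + k)
    simp [a1, a2, a3, a4] at e1 e2 e3 e4
    obtain ⟨i', j', m', hm', hcf⟩ := exists_conflict_of_count (w := w) (N := N) (i := p) (j := q)
      (n := k + 2) (by omega) (by omega) (by
        rw [show p + (k + 2) = p + 1 + k + 1 by ring, show q + (k + 2) = q + 1 + k + 1 by ring]
        omega)
    exact hmin m' (by omega) _ _ hcf
  have hj : ∀ l < m, w (j + 1 + l) = w (i + 1 + l) := fun l hl => (h7 l hl).symm
  cases hA : w (i + 1 + k)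
  · have hB : w (i + m - k) = true := by simpa [hA] using hkne
    refine fin i (j + (m - k)) (by omega) (by omega) h3 ?_ hA ?_ (hinner _ _ (fun _ _ => rfl) ?_)
    · rw [show j + (m - k) = j + 1 + (m - k - 1) by omega, hj _ (by omega), ← hB]
      congr 1; omega
    · rw [show j + (m - k) + 1 + k = j + m + 1 by omega, h6]; rfl
    · intro l hl
      rw [show j + (m - k) + 1 + l = j + 1 + (m - k + l) by ring, hj _ (by omega)]
      congr 1; ring
  · have hB : w (i + m - k) = false := by simpa [hA] using hkne
    refine fin (i + (m - k)) j (by omega) (by omega) ?_ h4 ?_ ?_ (hinner j _ ?_ ?_).symm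
    · rw [← hB]; congr 1; omega
    · rw [show i + (m - k) + 1 + k = i + m + 1 by omega, h5]
    · rw [hj k hk, hA]
    · intro l hl
      exact hj l (by omega)
    · intro l _; rfl

/-! ### Right special factors and balance of Sturmian words -/

theorem exists_last_ne {f g : ℕ → Bool} {n : ℕ} (h : ∃ k < n, f k ≠ g k) :
    ∃ k < n, f k ≠ g k ∧ ∀ l, k < l → l < n → f l = g l := by
  induction n with
  | zero => simp at h
  | succ n ih =>
    by_cases hn : f n = g n
    · obtain ⟨k, hk, hne⟩ := h
      have hkn : k ≠ n := by rintro rfl; exact hne hn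
      obtain ⟨k, hk, hne, hl⟩ := ih ⟨k, by omega, hne⟩
      refine ⟨k, by omega, hne, fun l h1 h2 => ?_⟩
      rcases eq_or_ne l n with rfl | h3
      · exact hn
      · exact hl l h1 (by omega)
    · exact ⟨n, by omega, hn, fun l h1 h2 => by omega⟩

/-- The factor of length `n` of `x` at position `i`. -/
def block (x : ℕ → Bool) (n i : ℕ) : List Bool :=
  List.ofFn fun j : Fin n => x (i + j)

theorem block_eq_iff {x y : ℕ → Bool} {n i j : ℕ} :
    block x n i = block y n j ↔ ∀ k < n, x (i + k) = y (j + k) := by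
  rw [block, block, List.ofFn_inj, funext_iff]
  exact ⟨fun h k hk => h ⟨k, hk⟩, fun h k => h k k.2⟩

theorem length_block (x : ℕ → Bool) (n i : ℕ) : (block x n i).length = n := by
  simp [block]

theorem block_succ (x : ℕ → Bool) (n i : ℕ) :
    block x (n + 1) i = block x n i ++ [x (i + n)] := by
  rw [block, List.ofFn_succ', List.concat_eq_append]
  rfl

theorem setOf_factors_eq_range (x : ℕ → Bool) (n : ℕ) :
    {u : List Bool | u ∈ factors x ∧ u.length = n} = Set.range (block x n) := by
  ext u
  constructor
  · rintro ⟨⟨i, hi⟩, rfl⟩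
    exact ⟨i, hi.symm⟩
  · rintro ⟨i, rfl⟩
    refine ⟨⟨i, ?_⟩, length_block x n i⟩
    change _ = block x _ i
    rw [length_block]

theorem finite_range_block (x : ℕ → Bool) (n : ℕ) : (Set.range (block x n)).Finite :=
  (List.finite_length_eq Bool n).subset (by rintro _ ⟨i, rfl⟩; exact length_block x n i)

/-- The right special factors of length `n` of `x`. -/
def rightSpecial (x : ℕ → Bool) (n : ℕ) : Set (List Bool) :=
  {s | ∃ i j, block x n i = s ∧ block x n j = s ∧ x (i + n) = false ∧ x (j + n) = true}

/-- Each factor has one or two right extensions, and those with two are the right special ones. -/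
theorem ncard_range_block_succ (x : ℕ → Bool) (n : ℕ) :
    (Set.range (block x (n + 1))).ncard =
      (Set.range (block x n)).ncard + (rightSpecial x n).ncard := by
  let T : Bool → Set (List Bool) := fun b => {s | ∃ i, block x n i = s ∧ x (i + n) = b}
  have hsub : ∀ b, T b ⊆ Set.range (block x n) := by
    rintro b _ ⟨i, rfl, -⟩
    exact ⟨i, rfl⟩
  have hfin : ∀ b, (T b).Finite := fun b => (finite_range_block x n).subset (hsub b)
  have hun : T false ∪ T true = Set.range (block x n) := by
    refine Set.Subset.antisymm (Set.union_subset (hsub _) (hsub _)) ?_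
    rintro _ ⟨i, rfl⟩
    cases h : x (i + n)
    · exact Or.inl ⟨i, rfl, h⟩
    · exact Or.inr ⟨i, rfl, h⟩
  have hin : T false ∩ T true = rightSpecial x n := by
    ext s
    constructor
    · rintro ⟨⟨i, h1, h2⟩, ⟨j, h3, h4⟩⟩
      exact ⟨i, j, h1, h3, h2, h4⟩
    · rintro ⟨i, j, h1, h3, h2, h4⟩
      exact ⟨⟨i, h1, h2⟩, ⟨j, h3, h4⟩⟩
  have hsucc : Set.range (block x (n + 1)) =
      (fun s => s ++ [false]) '' T false ∪ (fun s => s ++ [true]) '' T true := by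
    ext s
    constructor
    · rintro ⟨i, rfl⟩
      rw [block_succ]
      cases h : x (i + n)
      · exact Or.inl ⟨_, ⟨i, rfl, h⟩, rfl⟩
      · exact Or.inr ⟨_, ⟨i, rfl, h⟩, rfl⟩
    · rintro (⟨_, ⟨i, rfl, h⟩, rfl⟩ | ⟨_, ⟨i, rfl, h⟩, rfl⟩) <;>
        exact ⟨i, by rw [block_succ, h]⟩
  have hdis : Disjoint ((fun s => s ++ [false]) '' T false) ((fun s => s ++ [true]) '' T true) := by
    rw [Set.disjoint_left]
    rintro _ ⟨s, -, rfl⟩ ⟨t, -, h⟩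
    simpa using (List.append_inj' h rfl).2
  rw [hsucc, Set.ncard_union_eq hdis ((hfin _).image _) ((hfin _).image _),
    Set.ncard_image_of_injective _ (List.append_left_injective _),
    Set.ncard_image_of_injective _ (List.append_left_injective _), ← hun, ← hin,
    Set.ncard_union_add_ncard_inter _ _ (hfin _) (hfin _)]

theorem isSturmian_iff (x : ℕ → Bool) :
    IsSturmian x ↔ ∀ n, (rightSpecial x n).ncard = 1 := by
  simp only [IsSturmian, setOf_factors_eq_range]
  constructor
  · intro h n
    have := ncard_range_block_succ x n
    rw [h, h] at this
    omega
  · intro h n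
    induction n with
    | zero =>
      have : Set.range (block x 0) = {[]} := by
        ext s
        simp [block, eq_comm]
      simp [this]
    | succ n ih => rw [ncard_range_block_succ, ih, h]

theorem eq_of_notMem_rightSpecial {x : ℕ → Bool} {n i j : ℕ} (h : block x n i = block x n j)
    (hs : block x n i ∉ rightSpecial x n) : x (i + n) = x (j + n) := by
  by_contra hne
  apply hs
  cases hi : x (i + n)
  · exact ⟨i, j, rfl, h.symm, hi, by simpa [hi] using hne⟩
  · exact ⟨j, i, h.symm, rfl, by simpa [hi] using hne, hi⟩

/-- A factor that is not right special determines the next letter, so a repetition with no right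
special window in between perpetuates itself. -/
theorem periodic_of_block_eq {x : ℕ → Bool} {n i q : ℕ} (h : block x n i = block x n (i + q))
    (hs : ∀ k < q, block x n (i + k) ∉ rightSpecial x n) (hq : 0 < q) (r : ℕ) :
    x (i + r) = x (i + q + r) := by
  have key : ∀ r, block x n (i + r) = block x n (i + q + r) ∧
      block x n (i + r) ∉ rightSpecial x n := by
    intro r
    induction r using Nat.strong_induction_on with
    | _ r ih =>
      constructor
      · rcases r with _ | r
        · exact h
        · obtain ⟨h1, h2⟩ := ih r (by omega)
          have h3 := eq_of_notMem_rightSpecial h1 h2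
          rw [block_eq_iff] at h1 ⊢
          intro k hk
          by_cases hkn : k + 1 < n
          · have := h1 (k + 1) hkn
            rw [show i + (r + 1) + k = i + r + (k + 1) by ring,
              show i + q + (r + 1) + k = i + q + r + (k + 1) by ring, this]
          · rw [show i + (r + 1) + k = i + r + n by omega,
              show i + q + (r + 1) + k = i + q + r + n by omega, h3]
      · by_cases hr : r < q
        · exact hs r hr
        · obtain ⟨h1, h2⟩ := ih (r - q) (by omega)
          rw [h1, show i + q + (r - q) = i + r by omega] at h2
          exact h2
  by_cases hr : r < n
  · exact block_eq_iff.1 h r hr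
  · have := eq_of_notMem_rightSpecial (key (r - n)).1 (key (r - n)).2
    rwa [show i + (r - n) + n = i + r by omega,
      show i + q + (r - n) + n = i + q + r by omega] at this

theorem IsSturmian.not_periodic {x : ℕ → Bool} (hx : IsSturmian x) {i q : ℕ} (hq : 0 < q)
    (h : ∀ r, x (i + r) = x (i + q + r)) : False := by
  have hx' := hx (i + q)
  rw [setOf_factors_eq_range] at hx'
  have hsub : Set.range (block x (i + q)) ⊆
      ((Finset.range (i + q)).image (block x (i + q)) : Set (List Bool)) := by
    rintro _ ⟨p, rfl⟩
    induction p using Nat.strong_induction_on with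
    | _ p ih =>
      by_cases hp : p < i + q
      · exact Finset.mem_coe.2 (Finset.mem_image_of_mem _ (Finset.mem_range.2 hp))
      · have : block x (i + q) p = block x (i + q) (p - q) := by
          rw [block_eq_iff]
          intro k _
          have := h (p - q - i + k)
          rw [show i + (p - q - i + k) = p - q + k by omega,
            show i + q + (p - q - i + k) = p + k by omega] at this
          exact this.symm
        rw [this]
        exact ih _ (by omega)
  have h1 := Set.ncard_le_ncard hsub (Finset.finite_toSet _)
  rw [Set.ncard_coe_finset] at h1
  have h2 := Finset.card_image_le (s := Finset.range (i + q)) (f := block x (i + q))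
  rw [Finset.card_range] at h2
  omega

/-- The right special factor of length `m + 1` is `c t`, and it occurs at none of the `m + 2`
positions from `j` to `j + m + 1`. Only `m + 1` other factors of that length exist, so one repeats
there and the word is eventually periodic. -/
theorem IsSturmian.false_of_conflict {x : ℕ → Bool} (hx : IsSturmian x) {N : ℕ} {c : Bool}
    {i j m a : ℕ} (h : Conflict x N c i j m) (hpal : ∀ k < m, x (i + 1 + k) = x (i + m - k))
    (hrs : rightSpecial x (m + 1) = {block x (m + 1) a}) (ha : x a = c)
    (ht : ∀ k < m, x (a + 1 + k) = x (i + 1 + k)) : False := by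
  obtain ⟨-, -, h3, h4, h5, h6, h7⟩ := h
  have havoid : ∀ p ≤ m + 1, block x (m + 1) (j + p) ≠ block x (m + 1) a := by
    intro p hp he
    rw [block_eq_iff] at he
    have h0 : x (j + p) = c := by simpa [ha] using he 0 (by omega)
    rcases p with _ | p
    · simp [h4] at h0
    rcases eq_or_ne p m with rfl | hpm
    · rw [← add_assoc, h6] at h0
      simp at h0
    -- If `c t` occurred here, it would cover the final `d` of `d t d`. The palindrome property
    -- identifies that letter with the one at the start of the occurrence, which is `c`.
    have h8 := he (m - p) (by omega)
    rw [show j + (p + 1) + (m - p) = j + m + 1 by omega, h6,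
      show a + (m - p) = a + 1 + (m - p - 1) by omega, ht _ (by omega),
      show i + 1 + (m - p - 1) = i + m - p by omega, ← hpal p (by omega), h7 p (by omega),
      show j + 1 + p = j + (p + 1) by ring, h0] at h8
    simp at h8
  have hcard : (Set.range (block x (m + 1)) \ {block x (m + 1) a}).ncard = m + 1 := by
    rw [Set.ncard_sdiff_singleton_of_mem (Set.mem_range_self a), ← setOf_factors_eq_range, hx]
    rfl
  obtain ⟨p, hp, p', hp', hne, he⟩ := Set.exists_ne_map_eq_of_ncard_lt_of_maps_to
    (s := (Finset.range (m + 2) : Set ℕ)) (t := Set.range (block x (m + 1)) \ {block x (m + 1) a})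
    (f := fun p => block x (m + 1) (j + p))
    (by rw [hcard, Set.ncard_coe_finset, Finset.card_range]; omega)
    (fun p hp => ⟨⟨_, rfl⟩, havoid p (by simp at hp; omega)⟩)
    ((finite_range_block x (m + 1)).subset Set.sdiff_subset)
  have main : ∀ p p', p < p' → p' ≤ m + 1 →
      block x (m + 1) (j + p) = block x (m + 1) (j + p') → False := by
    intro p p' hlt hle he
    refine hx.not_periodic (i := j + p) (q := p' - p) (by omega) (periodic_of_block_eq
      (n := m + 1) ?_ ?_ (by omega))
    · rw [he]; congr 1; omega
    · intro k hk
      rw [hrs, add_assoc]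
      exact havoid _ (by omega)
  simp only [Finset.coe_range, Set.mem_Iio] at hp hp'
  rcases lt_or_gt_of_ne hne with hlt | hlt
  · exact main p p' hlt (by omega) he
  · exact main p' p hlt (by omega) he.symm

/-- Infinite Sturmian words are balanced. -/
theorem IsSturmian.balanced {x : ℕ → Bool} (hx : IsSturmian x) (N : ℕ) : Balanced x N := by
  intro c i j m hc
  obtain ⟨i, j, m, hc, hpal⟩ := hc.exists_palindrome
  have hone := (isSturmian_iff x).1 hx
  obtain ⟨s, hs⟩ := Set.ncard_eq_one.1 (hone (m + 1))
  obtain ⟨t, ht⟩ := Set.ncard_eq_one.1 (hone m)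
  obtain ⟨a, b, ha, hb, ha', hb'⟩ : s ∈ rightSpecial x (m + 1) := by rw [hs]; rfl
  have ht' : block x m (i + 1) = t := by
    have : block x m (i + 1) ∈ rightSpecial x m := by
      refine ⟨i + 1, j + 1, rfl, ?_, ?_, ?_⟩
      · exact (block_eq_iff.2 hc.2.2.2.2.2.2).symm
      · rw [← hc.2.2.2.2.1]; congr 1; ring
      · rw [show j + 1 + m = j + m + 1 by ring, hc.2.2.2.2.2.1]; rfl
    rwa [ht] at this
  have ht'' : block x m (a + 1) = t := by
    have : block x m (a + 1) ∈ rightSpecial x m := by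
      refine ⟨a + 1, b + 1, rfl, ?_, ?_, ?_⟩
      · rw [block_eq_iff]
        intro k hk
        have := block_eq_iff.1 (ha.trans hb.symm) (k + 1) (by omega)
        rw [add_assoc, add_assoc, add_comm 1 k, this]
      · rw [← ha']; congr 1; ring
      · rw [← hb']; congr 1; ring
    rwa [ht] at this
  have hti := block_eq_iff.1 (ht''.trans ht'.symm)
  rw [← ha] at hs
  cases hxa : x a
  · exact hx.false_of_conflict hc hpal hs hxa hti
  · have h7 := hc.2.2.2.2.2.2
    refine hx.false_of_conflict hc.symm (fun k hk => ?_) hs hxa fun k hk => ?_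
    · have := h7 (m - 1 - k) (by omega)
      rw [← h7 k hk, hpal k hk, show i + m - k = i + 1 + (m - 1 - k) by omega, this]
      congr 1; omega
    · rw [hti k hk, h7 k hk]

/-- After their last difference, two right special factors of equal length share a suffix, which can
be followed by either letter on both sides: this is a conflict. -/
theorem subsingleton_rightSpecial {x : ℕ → Bool} (hx : ∀ N, Balanced x N) (n : ℕ) :
    (rightSpecial x n).Subsingleton := by
  rintro s ⟨a, b, ha, hb, ha', hb'⟩ s' ⟨a', b', hc, hd, hc', hd'⟩
  by_contra hne
  rw [← ha, ← hc, block_eq_iff] at hne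
  push Not at hne
  obtain ⟨k, hk, hkne, hl⟩ := exists_last_ne hne
  have e1 := block_eq_iff.1 (ha.trans hb.symm)
  have e2 := block_eq_iff.1 (hc.trans hd.symm)
  obtain ⟨m, rfl⟩ : ∃ m, n = k + m + 1 := ⟨n - k - 1, by omega⟩
  cases hA : x (a + k)
  · have hB : x (a' + k) = true := by simpa [hA] using hkne
    -- The occurrences are chosen so that the letter after the common suffix matches the one before
    -- it. The length bound only has to be large enough.
    refine hx (a + b' + 2 * k + 2 * m + 3) false (a + k) (b' + k) m
      ⟨by omega, by omega, hA, by rw [← e2 k hk, hB]; rfl, ?_, ?_, fun l hlm => ?_⟩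
    · rw [← ha']; congr 1; ring
    · rw [show b' + k + m + 1 = b' + (k + m + 1) by ring, hd']; rfl
    · rw [show a + k + 1 + l = a + (k + 1 + l) by ring,
        show b' + k + 1 + l = b' + (k + 1 + l) by ring, hl _ (by omega) (by omega),
        e2 _ (by omega)]
  · have hB : x (a' + k) = false := by simpa [hA] using hkne
    refine hx (a' + b + 2 * k + 2 * m + 3) false (a' + k) (b + k) m
      ⟨by omega, by omega, hB, by rw [← e1 k hk, hA]; rfl, ?_, ?_, fun l hlm => ?_⟩
    · rw [← hc']; congr 1; ring
    · rw [show b + k + m + 1 = b + (k + m + 1) by ring, hb']; rfl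
    · rw [show a' + k + 1 + l = a' + (k + 1 + l) by ring,
        show b + k + 1 + l = b + (k + 1 + l) by ring, ← hl _ (by omega) (by omega),
        e1 _ (by omega)]

/-! ### Slopes, and extension of balanced words to Sturmian words -/

/-- A word whose number of `true` letters in windows of length `n` stays within distance `1` of
`α n`, with `α` irrational, is not eventually periodic. -/
theorem not_periodic_of_irrational {x : ℕ → Bool} {α : ℝ} (hα : Irrational α)
    (h : ∀ i n : ℕ, |(count x (i + n) - count x i : ℝ) - α * n| < 1) {i q : ℕ} (hq : 0 < q)
    (hper : ∀ r, x (i + r) = x (i + q + r)) : False := by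
  have hshift : ∀ r, count x (i + q + r) - count x (i + r) = count x (i + q) - count x i := by
    intro r
    induction r with
    | zero => simp
    | succ r ih =>
      have e1 := count_succ x (i + q + r)
      have e2 := count_succ x (i + r)
      rw [hper r] at e2
      rw [← add_assoc, ← add_assoc]
      omega
  set K := count x (i + q) - count x i with hK
  have hmul : ∀ k : ℕ, count x (i + k * q) = count x i + k * K := by
    intro k
    induction k with
    | zero => simp
    | succ k ih =>
      have := hshift (k * q)
      rw [show i + (k + 1) * q = i + q + k * q by ring]
      push_cast
      linarith
  have hsmall : ∀ k : ℕ, (k : ℝ) * |(K : ℝ) - α * q| < 1 := by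
    intro k
    have := h i (k * q)
    rw [hmul] at this
    push_cast at this
    rw [show (count x i + k * K - count x i : ℝ) - α * (k * q) = k * (K - α * q) by ring,
      abs_mul, Nat.abs_cast] at this
    exact this
  have hzero : |(K : ℝ) - α * q| = 0 := by
    by_contra hne
    have hpos : 0 < |(K : ℝ) - α * q| := lt_of_le_of_ne (abs_nonneg _) (Ne.symm hne)
    obtain ⟨k, hk⟩ := exists_nat_gt (1 / |(K : ℝ) - α * q|)
    rw [div_lt_iff₀ hpos] at hk
    exact lt_asymm hk (hsmall k)
  have hq' : (q : ℝ) ≠ 0 := by positivity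
  apply hα
  refine ⟨(K : ℚ) / q, ?_⟩
  push_cast
  rw [div_eq_iff hq']
  linarith [abs_eq_zero.1 hzero]

theorem isSturmian_of_irrational {x : ℕ → Bool} {α : ℝ} (hα : Irrational α)
    (h : ∀ i n : ℕ, |(count x (i + n) - count x i : ℝ) - α * n| < 1) : IsSturmian x := by
  have hno : ∀ N i j m, ¬ Conflict x N false i j m := by
    intro N i j m hc
    have h1 := abs_lt.1 (h i (m + 2))
    have h2 := abs_lt.1 (h j (m + 2))
    have h3 := hc.count_eq
    rw [add_assoc j, add_assoc i] at h3
    have h4 : (count x (j + (m + 2)) - count x j : ℝ) =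
        count x (i + (m + 2)) - count x i + 2 := by exact_mod_cast h3
    linarith [h1.1, h2.2]
  have hbal : ∀ N, Balanced x N := by
    intro N c i j m hc
    cases c
    · exact hno N i j m hc
    · exact hno N j i m hc.symm
  rw [isSturmian_iff]
  intro n
  rw [Set.ncard_eq_one]
  rcases (subsingleton_rightSpecial hbal n).eq_empty_or_singleton with he | ⟨s, hs⟩
  · exfalso
    -- With no right special factor of length `n`, the first repetition given by pigeonhole already
    -- makes the word eventually periodic.
    have hmaps : Set.MapsTo (block x n) Set.univ (Set.range (block x n)) :=
      fun i _ => ⟨i, rfl⟩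
    obtain ⟨i, -, j, -, hlt, hij⟩ :=
      Set.infinite_univ.exists_lt_map_eq_of_mapsTo hmaps (finite_range_block x n)
    obtain ⟨q, rfl⟩ := Nat.exists_eq_add_of_lt hlt
    rw [add_assoc] at hij
    exact not_periodic_of_irrational hα h (i := i) (q := q + 1) (by omega)
      (periodic_of_block_eq hij (by simp [he]) (by omega))
  · exact ⟨s, hs⟩

/-- Every lower bound for the slope lies below every upper bound. Windows of equal length follow
from balance; otherwise one cuts the shorter length off the longer window, as in Euclid's algorithm.
-/
theorem Balanced.slope_lt {w : ℕ → Bool} {N : ℕ} (hw : Balanced w N) (i j n m : ℕ)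
    (hn : 0 < n) (hm : 0 < m) (hi : i + n ≤ N) (hj : j + m ≤ N) :
    n * (count w (j + m) - count w j - 1) < m * (count w (i + n) - count w i + 1) := by
  have hbal : ∀ i j n, i + n ≤ N → j + n ≤ N →
      count w (j + n) - count w j ≤ count w (i + n) - count w i + 1 := by
    intro i j n hi hj
    by_contra hlt
    obtain ⟨_, _, _, -, hc⟩ := exists_conflict_of_count (w := w) hi hj (by omega)
    exact hw _ _ _ _ hc
  induction hk : n + m using Nat.strong_induction_on generalizing i j n m with
  | _ k ih =>
    rcases lt_trichotomy n m with hlt | rfl | hlt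
    · obtain ⟨d, rfl⟩ := Nat.exists_eq_add_of_lt hlt
      have h1 := ih (n + (d + 1)) (by omega) i (j + n) n (d + 1) hn (by omega) hi (by omega) rfl
      have h2 := hbal i j n hi (by omega)
      rw [show j + n + (d + 1) = j + (n + d + 1) by ring] at h1
      have hn' : (0 : ℤ) < n := by exact_mod_cast hn
      push_cast at h1 ⊢
      nlinarith
    · have h2 := hbal i j n hi hj
      have hn' : (0 : ℤ) < n := by exact_mod_cast hn
      nlinarith
    · obtain ⟨d, rfl⟩ := Nat.exists_eq_add_of_lt hlt
      have h1 := ih (d + 1 + m) (by omega) (i + m) j (d + 1) m (by omega) hm (by omega) hj rfl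
      have h2 := hbal i j m (by omega) hj
      rw [show i + m + (d + 1) = i + (m + d + 1) by ring] at h1
      have hm' : (0 : ℤ) < m := by exact_mod_cast hm
      push_cast at h1 ⊢
      nlinarith

theorem Balanced.exists_slope {w : ℕ → Bool} {N : ℕ} (hw : Balanced w N) :
    ∃ α : ℝ, Irrational α ∧ 0 < α ∧ α < 1 ∧ ∀ i n : ℕ, i + n ≤ N →
      |(count w (i + n) - count w i : ℝ) - α * n| < 1 := by
  classical
  let I : Finset (ℕ × ℕ) := (Finset.range (N + 1) ×ˢ Finset.range (N + 1)).filter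
    fun p => 0 < p.2 ∧ p.1 + p.2 ≤ N
  have hI : ∀ p, p ∈ I ↔ 0 < p.2 ∧ p.1 + p.2 ≤ N := by
    intro p
    simp only [I, Finset.mem_filter, Finset.mem_product, Finset.mem_range]
    omega
  let V : ℕ × ℕ → ℝ := fun p => count w (p.1 + p.2) - count w p.1
  -- The extra bounds 0 and 1 make the floors of the mechanical word increase by 0 or 1 at each
  -- step.
  let lo : Finset ℝ := insert 0 (I.image fun p => (V p - 1) / p.2)
  let hi : Finset ℝ := insert 1 (I.image fun p => (V p + 1) / p.2)
  have hV : ∀ i n : ℕ, count w i ≤ count w (i + n) ∧ count w (i + n) ≤ count w i + n := by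
    intro i n
    induction n with
    | zero => simp
    | succ n ih =>
      have := count_succ w (i + n)
      rw [← add_assoc]
      push_cast
      split_ifs at this <;> omega
  have hV0 : ∀ p, 0 ≤ V p := fun p => by
    have : (count w p.1 : ℝ) ≤ count w (p.1 + p.2) := by exact_mod_cast (hV p.1 p.2).1
    simp only [V]; linarith
  have hV1 : ∀ p, V p ≤ p.2 := fun p => by
    have : (count w (p.1 + p.2) : ℝ) ≤ count w p.1 + p.2 := by exact_mod_cast (hV p.1 p.2).2
    simp only [V]; linarith
  have hlohi : ∀ a ∈ lo, ∀ b ∈ hi, a < b := by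
    intro a ha b hb
    simp only [lo, hi, Finset.mem_insert, Finset.mem_image] at ha hb
    rcases ha with rfl | ⟨p, hp, rfl⟩ <;> rcases hb with rfl | ⟨r, hr, rfl⟩
    · exact one_pos
    · have : (0 : ℝ) < r.2 := by exact_mod_cast ((hI r).1 hr).1
      have := hV0 r
      positivity
    · have h2 : (0 : ℝ) < p.2 := by exact_mod_cast ((hI p).1 hp).1
      rw [div_lt_one h2]
      linarith [hV1 p]
    · have hp' := (hI p).1 hp
      have hr' := (hI r).1 hr
      have h2 : (0 : ℝ) < p.2 := by exact_mod_cast hp'.1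
      have h3 : (0 : ℝ) < r.2 := by exact_mod_cast hr'.1
      rw [div_lt_div_iff₀ h2 h3]
      have h4 := hw.slope_lt r.1 p.1 r.2 p.2 hr'.1 hp'.1 hr'.2 hp'.2
      have h5 : (r.2 : ℝ) * (V p - 1) < p.2 * (V r + 1) := by
        simp only [V]; exact_mod_cast h4
      linarith
  have hlo : lo.Nonempty := Finset.insert_nonempty _ _
  have hhi : hi.Nonempty := Finset.insert_nonempty _ _
  obtain ⟨α, hα, h1, h2⟩ := exists_irrational_btwn
    (hlohi _ (lo.max'_mem hlo) _ (hi.min'_mem hhi))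
  have hl : ∀ a ∈ lo, a < α := fun a ha => (lo.le_max' a ha).trans_lt h1
  have hu : ∀ b ∈ hi, α < b := fun b hb => h2.trans_le (hi.min'_le b hb)
  refine ⟨α, hα, hl 0 (Finset.mem_insert_self _ _), hu 1 (Finset.mem_insert_self _ _), ?_⟩
  intro i n hin
  rcases Nat.eq_zero_or_pos n with rfl | hn
  · simp
  have hn' : (0 : ℝ) < n := by exact_mod_cast hn
  have hmem : (i, n) ∈ I := (hI _).2 ⟨hn, hin⟩
  have h3 := hl _ (Finset.mem_insert_of_mem (Finset.mem_image_of_mem _ hmem))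
  have h4 := hu _ (Finset.mem_insert_of_mem (Finset.mem_image_of_mem _ hmem))
  rw [div_lt_iff₀ hn'] at h3
  rw [lt_div_iff₀ hn'] at h4
  simp only [V] at h3 h4
  rw [abs_lt]
  constructor <;> linarith

/-- Every finite balanced word is a prefix of an infinite Sturmian word. -/
theorem Balanced.exists_isSturmian {w : ℕ → Bool} {N : ℕ} (hw : Balanced w N) :
    ∃ x, IsSturmian x ∧ ∀ k < N, x k = w k := by
  obtain ⟨α, hα, h0, h1, hslope⟩ := hw.exists_slope
  obtain ⟨i₀, hi₀, hmax⟩ := Finset.exists_max_image (Finset.range (N + 1))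
    (fun i => (count w i : ℝ) - α * i) ⟨0, by simp⟩
  -- This is the least intercept for which the line of slope `α` lies on or above the graph of
  -- `count w` up to `N`; the slope bound keeps it less than 1 above.
  set ρ : ℝ := count w i₀ - α * i₀ with hρ
  have hfloor : ∀ i ≤ N, ⌊α * i + ρ⌋ = count w i := by
    intro i hi
    rw [Int.floor_eq_iff]
    have := hmax i (Finset.mem_range.2 (by omega))
    refine ⟨by linarith, ?_⟩
    have hi₀ := Finset.mem_range.1 hi₀
    rcases le_total i i₀ with hle | hle
    · obtain ⟨d, rfl⟩ := Nat.exists_eq_add_of_le hle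
      have := (abs_lt.1 (hslope i d (by omega))).2
      push_cast at hρ
      rw [hρ]
      linarith
    · obtain ⟨d, rfl⟩ := Nat.exists_eq_add_of_le hle
      have := (abs_lt.1 (hslope i₀ d (by omega))).1
      push_cast
      rw [hρ]
      linarith
  let x : ℕ → Bool := fun k => decide (⌊α * (k + 1 : ℕ) + ρ⌋ = ⌊α * k + ρ⌋ + 1)
  have hstep : ∀ k : ℕ, ⌊α * (k + 1 : ℕ) + ρ⌋ = ⌊α * k + ρ⌋ + if x k then 1 else 0 := by
    intro k
    have hle : ⌊α * k + ρ⌋ ≤ ⌊α * (k + 1 : ℕ) + ρ⌋ := by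
      apply Int.floor_le_floor
      push_cast
      linarith
    have hlt : ⌊α * (k + 1 : ℕ) + ρ⌋ < ⌊α * k + ρ⌋ + 2 := by
      rw [Int.floor_lt]
      have := Int.lt_floor_add_one (α * k + ρ)
      push_cast
      linarith
    simp only [x, decide_eq_true_eq]
    split_ifs <;> omega
  have hcount : ∀ k : ℕ, count x k = ⌊α * k + ρ⌋ - ⌊ρ⌋ := by
    intro k
    induction k with
    | zero => simp [count]
    | succ k ih => rw [count_succ, ih, hstep k]; ring
  refine ⟨x, isSturmian_of_irrational hα fun i n => ?_, fun k hk => ?_⟩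
  · rw [hcount, hcount, abs_lt]
    have a1 := Int.floor_le (α * i + ρ)
    have a2 := Int.lt_floor_add_one (α * i + ρ)
    have a3 := Int.floor_le (α * (i + n : ℕ) + ρ)
    have a4 := Int.lt_floor_add_one (α * (i + n : ℕ) + ρ)
    push_cast at a3 a4 ⊢
    constructor <;> linarith
  · have e1 := hstep k
    rw [hfloor k hk.le, hfloor (k + 1) hk, count_succ] at e1
    cases hA : x k <;> cases hB : w k <;> simp [hA, hB] at e1 ⊢

/-! ### Closed one-letter extensions -/

/-- The prefix of length `n` of `w` is closed, with a border of length `l`. -/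
def PrefixClosed (w : ℕ → Bool) (n : ℕ) : Prop :=
  ∃ l < n, (∀ k < l, w (n - l + k) = w k) ∧ ∀ i, 0 < i → i < n - l → ∃ k < l, w (i + k) ≠ w k

theorem PrefixClosed.congr {u v : ℕ → Bool} {n : ℕ} (h : ∀ k < n, u k = v k)
    (hu : PrefixClosed u n) : PrefixClosed v n := by
  obtain ⟨l, hl, h1, h2⟩ := hu
  refine ⟨l, hl, fun k hk => ?_, fun i hi hi' => ?_⟩
  · rw [← h _ (by omega), ← h _ (by omega), h1 k hk]
  · obtain ⟨k, hk, hne⟩ := h2 i hi hi'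
    exact ⟨k, hk, by rwa [← h _ (by omega), ← h _ (by omega)]⟩

theorem PrefixClosed.border_pos {w : ℕ → Bool} {n l : ℕ} (hn : 1 < n)
    (h : ∀ i, 0 < i → i < n - l → ∃ k < l, w (i + k) ≠ w k) : 0 < l := by
  rcases Nat.eq_zero_or_pos l with rfl | hl
  · obtain ⟨k, hk, -⟩ := h 1 one_pos hn
    omega
  · exact hl

/-- If the borders have different lengths, the shorter one starts the final occurrence of the longer
and ends inside the common prefix, an internal occurrence. If the lengths agree, both last letters
equal the same earlier letter. -/
theorem not_prefixClosed_both {u v : ℕ → Bool} {p : ℕ} (hp : 0 < p) (h : ∀ k < p, u k = v k)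
    (hne : u p ≠ v p) (hu : PrefixClosed u (p + 1)) : ¬ PrefixClosed v (p + 1) := by
  rintro ⟨l', hl', h1', h2'⟩
  obtain ⟨l, hl, h1, h2⟩ := hu
  have := PrefixClosed.border_pos (by omega) h2
  have := PrefixClosed.border_pos (by omega) h2'
  rcases lt_trichotomy l l' with hlt | rfl | hlt
  · obtain ⟨k, hk, hk'⟩ := h2 (p + 1 - l') (by omega) (by omega)
    rw [h _ (by omega), h _ (by omega)] at hk'
    exact hk' (h1' k (by omega))
  · have e1 := h1 (l - 1) (by omega)
    have e2 := h1' (l - 1) (by omega)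
    rw [show p + 1 - l + (l - 1) = p by omega] at e1 e2
    rw [e1, e2] at hne
    exact hne (h _ (by omega))
  · obtain ⟨k, hk, hk'⟩ := h2' (p + 1 - l) (by omega) (by omega)
    rw [← h _ (by omega), ← h _ (by omega)] at hk'
    exact hk' (h1 k (by omega))

/-- If a word of length `p` has two balanced extensions by one letter, then the extension that
prolongs its longest border is closed. -/
theorem prefixClosed_of_longest_border {f g : ℕ → Bool} {p l : ℕ} (h : ∀ k < p, f k = g k)
    (hne : f p ≠ g p) (hf : Balanced f (p + 1)) (hg : Balanced g (p + 1)) (hl : l < p)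
    (hb : ∀ k < l, f (p - l + k) = f k)
    (hmax : ∀ l', l < l' → l' < p → ¬ ∀ k < l', f (p - l' + k) = f k) (hx : f p = f l) :
    PrefixClosed f (p + 1) := by
  classical
  refine ⟨l + 1, by omega, fun k hk => ?_, fun i hi hi' => ?_⟩
  · rcases eq_or_ne k l with rfl | hkl
    · rw [show p + 1 - (k + 1) + k = p by omega, hx]
    · rw [show p + 1 - (l + 1) = p - l by omega]
      exact hb k (by omega)
  by_contra hcon
  push Not at hcon
  -- An internal occurrence at `i` cannot match the prefix all the way to `p`, as that would be a
  -- border longer than `l`. So the prefix of some length `H > l` occurs at 0 and at `i`, followed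
  -- by different letters.
  have hex : ∃ k, k < p - i ∧ f (i + k) ≠ f k := by
    have := hmax (p - i) (by omega) (by omega)
    push Not at this
    rwa [show p - (p - i) = i by omega] at this
  obtain ⟨H, hHp, hHne, hHmin⟩ : ∃ H, H < p - i ∧ f (i + H) ≠ f H ∧ ∀ k < H, f (i + k) = f k :=
    ⟨Nat.find hex, (Nat.find_spec hex).1, (Nat.find_spec hex).2, fun k hk => by
      by_contra hk'
      exact Nat.find_min hex hk ⟨hk.trans (Nat.find_spec hex).1, hk'⟩⟩
  have hlH : l < H := by
    by_contra hle
    exact hHne (hcon H (by omega))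
  have hex' := hmax H hlH (by omega)
  push Not at hex'
  obtain ⟨e, heH, hene, hel⟩ := exists_last_ne (f := fun k => f (p - H + k)) hex'
  -- The suffix of length `H` of the common word is not its prefix; `e` is their last difference.
  -- The position `q` (0 or `i`) and the extension `y` (`f` or `g`) are chosen so that the letters
  -- after the part beyond `e` repeat the two letters at `e`, which is a conflict in `y`.
  obtain ⟨q, hq, hqH, hqk⟩ : ∃ q, q + H < p ∧ f (q + H) = f e ∧ ∀ k < H, f (q + k) = f k := by
    by_cases h0 : f H = f e
    · exact ⟨0, by omega, by simpa using h0, fun k _ => by simp⟩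
    · refine ⟨i, by omega, ?_, hHmin⟩
      cases hA : f (i + H) <;> cases hB : f H <;> cases hC : f e <;> simp_all
  obtain ⟨y, hy, hyp, hyb⟩ : ∃ y : ℕ → Bool, (∀ k < p, y k = f k) ∧ y p = f (p - H + e) ∧
      Balanced y (p + 1) := by
    by_cases h0 : f p = f (p - H + e)
    · exact ⟨f, fun _ _ => rfl, h0, hf⟩
    · refine ⟨g, fun k hk => (h k hk).symm, ?_, hg⟩
      cases hA : f p <;> cases hB : g p <;> cases hC : f (p - H + e) <;> simp_all
  have hfe : f e = !f (p - H + e) := by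
    cases hA : f e <;> cases hB : f (p - H + e) <;> simp_all
  refine hyb (f (p - H + e)) (p - H + e) (q + e) (H - 1 - e)
    ⟨by omega, by omega, hy _ (by omega), ?_, ?_, ?_, fun k hk => ?_⟩
  · rw [hy _ (by omega), hqk e heH, hfe]
  · rw [show p - H + e + (H - 1 - e) + 1 = p by omega, hyp]
  · rw [show q + e + (H - 1 - e) + 1 = q + H by omega, hy _ (by omega), hqH, hfe]
  · have := hel (e + 1 + k) (by omega) (by omega)
    rw [hy _ (by omega), hy _ (by omega), show q + e + 1 + k = q + (e + 1 + k) by ring,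
      hqk _ (by omega), ← this]
    congr 1; ring

theorem prefixClosed_or {u v : ℕ → Bool} {p : ℕ} (hp : 0 < p) (h : ∀ k < p, u k = v k)
    (hne : u p ≠ v p) (hu : Balanced u (p + 1)) (hv : Balanced v (p + 1)) :
    PrefixClosed u (p + 1) ∨ PrefixClosed v (p + 1) := by
  classical
  let P : ℕ → Prop := fun l => ∀ k < l, u (p - l + k) = u k
  obtain ⟨l, hl, hb, hmax⟩ : ∃ l, l < p ∧ P l ∧ ∀ l', l < l' → l' < p → ¬ P l' :=
    ⟨Nat.findGreatest P (p - 1), by have := Nat.findGreatest_le (P := P) (p - 1); omega,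
      Nat.findGreatest_spec (P := P) (Nat.zero_le _) (fun k hk => by omega),
      fun l' h1 h2 => Nat.findGreatest_is_greatest h1 (by omega)⟩
  by_cases hx : u p = u l
  · exact Or.inl (prefixClosed_of_longest_border h hne hu hv hl hb hmax hx)
  · refine Or.inr (prefixClosed_of_longest_border (fun k hk => (h k hk).symm) hne.symm hv hu hl
      (fun k hk => ?_) (fun l' h1 h2 h3 => hmax l' h1 h2 fun k hk => ?_) ?_)
    · rw [← h _ (by omega), ← h _ (by omega), hb k hk]
    · rw [h _ (by omega), h _ (by omega), h3 k hk]
    · rw [← h l hl]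
      cases hA : u p <;> cases hB : v p <;> cases hC : u l <;> simp_all

/-- This is how one bit of the oc-sequence decides the next letter of a balanced word. -/
theorem prefixClosed_not_iff {u v : ℕ → Bool} {p : ℕ} (hp : 0 < p) (h : ∀ k < p, u k = v k)
    (hne : u p ≠ v p) (hu : Balanced u (p + 1)) (hv : Balanced v (p + 1)) :
    ¬ (PrefixClosed u (p + 1) ↔ PrefixClosed v (p + 1)) := by
  intro hiff
  have h1 := not_prefixClosed_both hp h hne
  rcases prefixClosed_or hp h hne hu hv with h2 | h2
  · exact h1 h2 (hiff.1 h2)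
  · exact h1 (hiff.2 h2) h2

/-! ### Minimal unbalanced words -/

theorem Balanced.not_conflict_of_tail {w : ℕ → Bool} {n : ℕ} {c : Bool} {i j m : ℕ}
    (htail : Balanced (fun k => w (1 + k)) (n - 1)) (hi : 0 < i) (hj : 0 < j) :
    ¬ Conflict w n c i j m := by
  rintro ⟨h1, h2, h3, h4, h5, h6, h7⟩
  refine htail c (i - 1) (j - 1) m ⟨by omega, by omega, ?_, ?_, ?_, ?_, fun k hk => ?_⟩ <;>
    beta_reduce
  · rw [show 1 + (i - 1) = i by omega, h3]
  · rw [show 1 + (j - 1) = j by omega, h4]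
  · rw [show 1 + (i - 1 + m + 1) = i + m + 1 by omega, h5]
  · rw [show 1 + (j - 1 + m + 1) = j + m + 1 by omega, h6]
  · rw [show 1 + (i - 1 + 1 + k) = i + 1 + k by omega,
      show 1 + (j - 1 + 1 + k) = j + 1 + k by omega, h7 k hk]

/-- A minimal unbalanced word has no nonempty proper border, hence it is open. -/
theorem Conflict.not_prefixClosed {w : ℕ → Bool} {n : ℕ} {c : Bool} {j m : ℕ}
    (h : Conflict w n c 0 j m) (hn : n = j + m + 2) (hj : 0 < j)
    (hpal : ∀ k < m, w (1 + k) = w (m - k)) (htail : Balanced (fun k => w (1 + k)) (n - 1)) :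
    ¬ PrefixClosed w n := by
  rintro ⟨l, hl, hb, hint⟩
  have hl0 := PrefixClosed.border_pos (by omega) hint
  obtain ⟨-, -, h3, h4, h5, h6, h7⟩ := h
  simp only [zero_add] at h5 h7
  -- A long border repeats `c t c` away from position 0, a conflict inside the balanced tail. A
  -- short one is a suffix of `t d` starting with `c` and a prefix of `c t` ending with `d`, which
  -- the palindrome `t` forbids.
  by_cases hlm : m + 2 ≤ l
  · refine htail.not_conflict_of_tail (i := n - l) (by omega) hj
      ⟨by omega, by omega, ?_, h4, ?_, h6, fun k hk => ?_⟩
    · rw [← add_zero (n - l), hb 0 hl0, h3]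
    · rw [add_assoc, hb _ (by omega), h5]
    · rw [add_assoc, hb _ (by omega), h7 k hk]
  · have e0 := hb 0 hl0
    have e1 := hb (l - 1) (by omega)
    rw [show n - l + (l - 1) = j + m + 1 by omega, h6] at e1
    rw [h3, add_zero] at e0
    rcases eq_or_ne l 1 with rfl | hl1
    · simp [h3] at e1
    · have e2 := hpal (l - 2) (by omega)
      have e3 := h7 (m - (l - 1)) (by omega)
      rw [show j + 1 + (m - (l - 1)) = n - l by omega, e0,
        show 1 + (m - (l - 1)) = m - (l - 2) by omega, ← e2,
        show 1 + (l - 2) = l - 1 by omega, ← e1] at e3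
      simp at e3

/-- Changing the last letter of a minimal unbalanced word yields an open word. -/
theorem Conflict.not_prefixClosed_of_last_ne {w v : ℕ → Bool} {n : ℕ} {c : Bool} {j m : ℕ}
    (h : Conflict w n c 0 j m) (hn : n = j + m + 2) (hj : 0 < j)
    (htail : Balanced (fun k => w (1 + k)) (n - 1)) (hv : ∀ k < n - 1, v k = w k)
    (hlast : v (n - 1) ≠ w (n - 1)) : ¬ PrefixClosed v n := by
  rintro ⟨l, hl, hb, hint⟩
  have hl0 := PrefixClosed.border_pos (by omega) hint
  obtain ⟨-, -, h3, h4, h5, h6, h7⟩ := h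
  simp only [zero_add] at h5 h7
  have hlast' : v (n - 1) = c := by
    rw [show n - 1 = j + m + 1 by omega] at hlast ⊢
    rw [h6] at hlast
    cases c <;> simp_all
  have e0 := hb 0 hl0
  rcases lt_trichotomy l (m + 2) with hlm | rfl | hlm
  -- The new word ends in `d t c`, so a border this short is also a suffix of the prefix `c t c`.
  -- That occurrence is internal since `j > 0`.
  · obtain ⟨k, hk, hne⟩ := hint (m + 2 - l) (by omega) (by omega)
    apply hne
    rw [← hb k hk, hv _ (by omega)]
    by_cases hkl : k + 1 = l
    · rw [show m + 2 - l + k = m + 1 by omega, h5, show n - l + k = n - 1 by omega, hlast']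
    · rw [hv _ (by omega), show m + 2 - l + k = 1 + (m + 1 - l + k) by omega, h7 _ (by omega)]
      congr 1; omega
  · rw [hv _ (by omega), hv _ (by omega), show n - (m + 2) + 0 = j by omega, h3, h4] at e0
    simp at e0
  · refine htail.not_conflict_of_tail (i := n - l) (by omega) hj
      ⟨by omega, by omega, ?_, h4, ?_, h6, fun k hk => ?_⟩
    · rw [← hv _ (by omega), ← add_zero (n - l), e0, hv _ (by omega), h3]
    · rw [add_assoc, ← hv _ (by omega), hb _ (by omega), hv _ (by omega), h5]
    · rw [add_assoc, ← hv _ (by omega), hb _ (by omega), hv _ (by omega), h7 k hk]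

/-! ### Passage to finite lists -/

/-- The letters of a finite word, followed by `false` forever. -/
def letters (u : List Bool) (k : ℕ) : Bool := u.getD k false

theorem letters_of_lt {u : List Bool} {k : ℕ} (h : k < u.length) : letters u k = u[k] := by
  simp [letters, h]

theorem ext_letters {u v : List Bool} (hl : u.length = v.length)
    (h : ∀ k < u.length, letters u k = letters v k) : u = v :=
  List.ext_getElem hl fun k h1 h2 => by rw [← letters_of_lt h1, ← letters_of_lt h2, h k h1]

theorem letters_block {x : ℕ → Bool} {n i k : ℕ} (hk : k < n) :
    letters (block x n i) k = x (i + k) := by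
  rw [letters_of_lt (by rwa [length_block])]
  simp [block]

theorem letters_take {u : List Bool} {n k : ℕ} (hk : k < n) (hn : n ≤ u.length) :
    letters (u.take n) k = letters u k := by
  rw [letters_of_lt (by simp; omega), letters_of_lt (by omega), List.getElem_take]

theorem Balanced.of_shift {x w : ℕ → Bool} {N n i : ℕ} (hx : Balanced x N) (hn : i + n ≤ N)
    (h : ∀ k < n, w k = x (i + k)) : Balanced w n := by
  rintro c a b m ⟨h1, h2, h3, h4, h5, h6, h7⟩
  refine hx c (i + a) (i + b) m ⟨by omega, by omega, ?_, ?_, ?_, ?_, fun k hk => ?_⟩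
  · rw [← h _ (by omega), h3]
  · rw [← h _ (by omega), h4]
  · rw [show i + a + m + 1 = i + (a + m + 1) by ring, ← h _ (by omega), h5]
  · rw [show i + b + m + 1 = i + (b + m + 1) by ring, ← h _ (by omega), h6]
  · rw [show i + a + 1 + k = i + (a + 1 + k) by ring, show i + b + 1 + k = i + (b + 1 + k) by ring,
      ← h _ (by omega), ← h _ (by omega), h7 k hk]

theorem block_mem_factors (x : ℕ → Bool) (n i : ℕ) : block x n i ∈ factors x := by
  have : block x n i ∈ {u : List Bool | u ∈ factors x ∧ u.length = n} := by
    rw [setOf_factors_eq_range]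
    exact ⟨i, rfl⟩
  exact this.1

/-- The finite Sturmian words are the finite balanced words. -/
theorem mem_St_iff (u : List Bool) : u ∈ St ↔ Balanced (letters u) u.length := by
  constructor
  · rintro ⟨x, hx, i, hi⟩
    refine (hx.balanced (i + u.length)).of_shift le_rfl fun k hk => ?_
    have hi : u = block x u.length i := hi
    rw [← letters_block (x := x) (i := i) hk, ← hi]
  · intro h
    obtain ⟨x, hx, hk⟩ := h.exists_isSturmian
    have : u = block x u.length 0 :=
      ext_letters (length_block _ _ _).symm fun k hk' => by
        rw [letters_block hk', zero_add, hk k hk']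
    exact ⟨x, hx, by rw [this]; exact block_mem_factors _ _ _⟩

theorem mem_St_of_infix {u v : List Bool} (hu : u ∈ St) (h : v <:+: u) : v ∈ St := by
  rw [mem_St_iff] at hu ⊢
  obtain ⟨s, t, rfl⟩ := h
  refine hu.of_shift (i := s.length) (by simp) fun k hk => ?_
  rw [letters_of_lt hk, letters_of_lt (by simp; omega)]
  simp [hk]

theorem isClosedWord_iff {w : List Bool} (hw : w ≠ []) :
    IsClosedWord w ↔ PrefixClosed (letters w) w.length := by
  constructor
  · rintro (h | ⟨v, hne, hpre, hsuf, hint⟩)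
    · exact absurd h hw
    have hlt : v.length < w.length :=
      lt_of_le_of_ne hpre.length_le fun h => hne (hpre.eq_of_length h)
    have hv : ∀ k < v.length, letters v k = letters w k := by
      intro k hk
      rw [letters_of_lt hk, letters_of_lt (by omega), hpre.getElem]
    refine ⟨v.length, hlt, fun k hk => ?_, fun i hi hi' => ?_⟩
    · rw [← hv k hk]
      obtain ⟨s, rfl⟩ := hsuf
      rw [letters_of_lt hk, letters_of_lt (by simp; omega)]
      simp
    · by_contra hcon
      push Not at hcon
      have hdec : w = w.take i ++ v ++ w.drop (i + v.length) := by
        refine ext_letters (by simp; omega) fun k hk => ?_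
        rw [letters_of_lt hk, letters_of_lt (by simp; omega)]
        by_cases h1 : k < i
        · rw [List.getElem_append_left (by simp; omega), List.getElem_append_left (by simp; omega),
            List.getElem_take]
        · by_cases h2 : k < i + v.length
          · rw [List.getElem_append_left (by simp; omega), List.getElem_append_right (by simp; omega)]
            have := hcon (k - i) (by omega)
            rw [show i + (k - i) = k by omega, ← hv (k - i) (by omega), letters_of_lt hk,
              letters_of_lt (by omega)] at this
            rw [this]
            congr 1
            simp; omega
          · rw [List.getElem_append_right (by simp; omega), List.getElem_drop]
            congr 1
            simp; omega
      rcases hint _ _ hdec with h | h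
      · have := congrArg List.length h
        rw [List.length_take, List.length_nil] at this
        omega
      · have := congrArg List.length h
        simp at this
        omega
  · rintro ⟨l, hl, hb, hint⟩
    refine Or.inr ⟨w.take l, fun h => ?_, List.take_prefix _ _, ?_, ?_⟩
    · have := congrArg List.length h
      simp at this
      omega
    · have : w.take l = w.drop (w.length - l) := by
        refine ext_letters (by simp; omega) fun k hk => ?_
        have hk' : k < l := by simp at hk; omega
        rw [letters_take hk' hl.le, ← hb k hk', letters_of_lt (by omega),
          letters_of_lt (by simp; omega), List.getElem_drop]
      rw [this]
      exact List.drop_suffix _ _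
    · intro p s hps
      by_contra hcon
      push Not at hcon
      have hp := List.length_pos_iff.2 hcon.1
      have hs := List.length_pos_iff.2 hcon.2
      have hlen := congrArg List.length hps
      simp at hlen
      obtain ⟨k, hk, hne⟩ := hint p.length hp (by omega)
      apply hne
      have h1 : letters w (p.length + k) = letters (p ++ w.take l ++ s) (p.length + k) := by
        rw [← hps]
      rw [h1, ← letters_take hk hl.le, letters_of_lt (by simp; omega),
        letters_of_lt (by simp; omega), List.getElem_append_left (by simp; omega),
        List.getElem_append_right (by omega)]
      congr 1
      omega

theorem isClosedWord_take_iff {w : List Bool} {n : ℕ} (h0 : 0 < n) (hn : n ≤ w.length) :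
    IsClosedWord (w.take n) ↔ PrefixClosed (letters w) n := by
  have hlen : (w.take n).length = n := by simp [hn]
  rw [isClosedWord_iff (List.length_pos_iff.1 (by omega)), hlen]
  exact ⟨PrefixClosed.congr fun k hk => letters_take hk hn,
    PrefixClosed.congr fun k hk => (letters_take hk hn).symm⟩

theorem oc_eq_iff {u v : List Bool} : oc u = oc v ↔ u.length = v.length ∧
    ∀ n < u.length, (PrefixClosed (letters u) (n + 1) ↔ PrefixClosed (letters v) (n + 1)) := by
  classical
  have hentry : ∀ {w : List Bool} {n : ℕ} (h : n < (oc w).length),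
      (oc w)[n] = 1 ↔ PrefixClosed (letters w) (n + 1) := by
    intro w n h
    have hn : n < w.length := by simpa [oc] using h
    rw [← isClosedWord_take_iff (by omega) hn]
    simp [oc]
  have hlen : ∀ w : List Bool, (oc w).length = w.length := fun w => by simp [oc]
  constructor
  · intro h
    have hl : u.length = v.length := by rw [← hlen u, ← hlen v, h]
    refine ⟨hl, fun n hn => ?_⟩
    rw [← hentry (by rwa [hlen]), ← hentry (by rw [hlen]; omega)]
    simp only [h]
  · rintro ⟨hl, h⟩
    refine List.ext_getElem (by rw [hlen, hlen, hl]) fun n h1 h2 => ?_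
    have := h n (by rwa [hlen] at h1)
    rw [← hentry h1, ← hentry h2] at this
    generalize (oc u)[n] = a at this
    generalize (oc v)[n] = b at this
    revert a b
    decide

theorem Balanced.map {w : ℕ → Bool} {N : ℕ} (h : Balanced w N) (σ : Equiv.Perm Bool) :
    Balanced (fun k => σ (w k)) N := by
  have hnot : ∀ b, σ.symm (!b) = !σ.symm b := by
    intro b
    have : σ.symm (!b) ≠ σ.symm b := by simp
    revert this
    cases σ.symm (!b) <;> cases σ.symm b <;> simp
  rintro c i j m ⟨h1, h2, h3, h4, h5, h6, h7⟩
  refine h (σ.symm c) i j m ⟨h1, h2, ?_, ?_, ?_, ?_, fun k hk => σ.injective (h7 k hk)⟩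
  · rw [Equiv.eq_symm_apply]; exact h3
  · rw [← hnot, Equiv.eq_symm_apply]; exact h4
  · rw [Equiv.eq_symm_apply]; exact h5
  · rw [← hnot, Equiv.eq_symm_apply]; exact h6

theorem prefixClosed_map_iff {w : ℕ → Bool} {n : ℕ} (σ : Equiv.Perm Bool) :
    PrefixClosed (fun k => σ (w k)) n ↔ PrefixClosed w n := by
  simp [PrefixClosed]

theorem letters_map {u : List Bool} (σ : Equiv.Perm Bool) {k : ℕ} (hk : k < u.length) :
    letters (u.map σ) k = σ (letters u k) := by
  rw [letters_of_lt (by simpa using hk), letters_of_lt hk, List.getElem_map]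

/-! ### Membership in the class and maximality -/

theorem isomorphic_of_oc_eq {u v : List Bool} (hu : u ∈ St) (hv : v ∈ St) (h : oc u = oc v) :
    Isomorphic u v := by
  classical
  rw [mem_St_iff] at hu hv
  obtain ⟨hl, hoc⟩ := oc_eq_iff.1 h
  -- The swap is the identity when the first letters agree, and also for empty words by the default
  -- letter.
  let σ : Equiv.Perm Bool := Equiv.swap (letters u 0) (letters v 0)
  have hσ : σ (letters u 0) = letters v 0 := Equiv.swap_apply_left _ _
  refine ⟨σ, (ext_letters (by simpa using hl) fun k hk => ?_).symm⟩
  rw [List.length_map] at hk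
  rw [letters_map σ hk]
  induction k using Nat.strong_induction_on with
  | _ k ih =>
    rcases Nat.eq_zero_or_pos k with rfl | hpos
    · exact hσ
    by_contra hne
    refine prefixClosed_not_iff (u := fun k => σ (letters u k)) hpos
      (fun l hlk => ih l hlk (by omega)) hne ?_ ?_ ?_
    · exact (hu.map σ).of_shift (i := 0) (by omega) fun k _ => by simp
    · exact hv.of_shift (i := 0) (by omega) fun k _ => by simp
    · rw [prefixClosed_map_iff]
      exact hoc k hk

theorem St_mem_ClassC : St ∈ ClassC :=
  ⟨fun _ hu _ h => mem_St_of_infix hu h, fun _ hu _ hv h => isomorphic_of_oc_eq hu hv h⟩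

/-- In a minimal unbalanced word, the two conflicting factors can be taken to be a prefix and a
suffix with palindromic middle. -/
theorem exists_conflict_zero {w : ℕ → Bool} {n : ℕ} (hw : ¬ Balanced w n)
    (hinit : Balanced w (n - 1)) (htail : Balanced (fun k => w (1 + k)) (n - 1)) :
    ∃ c j m, Conflict w n c 0 j m ∧ n = j + m + 2 ∧ 0 < j ∧ ∀ k < m, w (1 + k) = w (m - k) := by
  obtain ⟨c, i, j, m, hc⟩ : ∃ c i j m, Conflict w n c i j m := by
    unfold Balanced at hw
    push Not at hw
    exact hw
  obtain ⟨i, j, m, hc, hpal⟩ := hc.exists_palindrome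
  have hc' := hc
  obtain ⟨h1, h2, h3, h4, h5, h6, h7⟩ := hc
  have hij : i ≠ j := by rintro rfl; simp [h3] at h4
  have hend : i + m + 2 = n ∨ j + m + 2 = n := by
    by_contra hcon
    exact hinit _ _ _ _ ⟨by omega, by omega, h3, h4, h5, h6, h7⟩
  have hstart : i = 0 ∨ j = 0 := by
    by_contra hcon
    exact htail.not_conflict_of_tail (by omega) (by omega) hc'
  rcases hstart with rfl | rfl
  · exact ⟨false, j, m, hc', by omega, by omega, by simpa using hpal⟩
  · refine ⟨true, i, m, hc'.symm, by omega, by omega, fun k hk => ?_⟩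
    have e1 := h7 k hk
    have e2 := h7 (m - 1 - k) (by omega)
    rw [zero_add] at e1 e2
    rw [← e1, hpal k hk, show i + m - k = i + 1 + (m - 1 - k) by omega, e2]
    congr 1; omega

theorem subset_St_of_mem_ClassC {A : Set (List Bool)} (hA : A ∈ ClassC) (hSt : St ⊆ A) :
    A ⊆ St := by
  obtain ⟨hfac, hoc⟩ := hA
  intro w
  induction hlen : w.length using Nat.strong_induction_on generalizing w with
  | _ n ih =>
    intro hwA
    by_contra hwSt
    have hsub : ∀ v, v <:+: w → v.length < n → v ∈ St :=
      fun v hv hlt => ih v.length hlt rfl (hfac w hwA v hv)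
    have hunb : ¬ Balanced (letters w) n := by rwa [← hlen, ← mem_St_iff]
    have hn : 0 < n := by
      rcases Nat.eq_zero_or_pos n with rfl | h
      · exact absurd (fun c i j m hc => absurd hc.1 (by omega)) hunb
      · exact h
    have hinit : Balanced (letters w) (n - 1) := by
      have := (mem_St_iff _).1 (hsub (w.take (n - 1)) (List.take_prefix _ _).isInfix
        (by simp; omega))
      refine this.of_shift (i := 0) (by simp; omega) fun k hk => ?_
      rw [zero_add, letters_take hk (by omega)]
    have htail : Balanced (fun k => letters w (1 + k)) (n - 1) := by
      have := (mem_St_iff _).1 (hsub (w.drop 1) (List.drop_suffix _ _).isInfix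
        (by simp; omega))
      refine this.of_shift (i := 0) (by simp; omega) fun k hk => ?_
      rw [zero_add, letters_of_lt (by omega), letters_of_lt (by simp; omega), List.getElem_drop]
    obtain ⟨c, j, m, hc, hnj, hj, hpal⟩ := exists_conflict_zero hunb hinit htail
    -- The prefix of length `n` of `x` is the competitor of `w`: it is in `St` and `w` is not, so it
    -- differs from `w` exactly in the last letter.
    obtain ⟨x, hx, hxw⟩ := hinit.exists_isSturmian
    have hv : block x n 0 ∈ St := ⟨x, hx, block_mem_factors _ _ _⟩
    have hvl : ∀ k < n, letters (block x n 0) k = x k := fun k hk => by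
      rw [letters_block hk, zero_add]
    have hlast : x (n - 1) ≠ letters w (n - 1) := by
      intro h
      apply hwSt
      have : w = block x n 0 := by
        refine ext_letters (by rw [hlen, length_block]) fun k hk => ?_
        rw [hvl k (by omega)]
        rcases eq_or_ne k (n - 1) with rfl | hkn
        · exact h.symm
        · exact (hxw k (by omega)).symm
      rwa [this]
    have hopen := hc.not_prefixClosed hnj hj hpal htail
    have hopen' : ¬ PrefixClosed (letters (block x n 0)) n := fun h =>
      hc.not_prefixClosed_of_last_ne hnj hj htail hxw hlast (h.congr hvl)
    have heq : oc w = oc (block x n 0) := by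
      refine oc_eq_iff.2 ⟨by rw [hlen, length_block], fun k hk => ?_⟩
      rcases eq_or_ne (k + 1) n with rfl | hkn
      · simp [hopen, hopen']
      · have hag : ∀ l < k + 1, letters w l = letters (block x n 0) l := fun l hl => by
          rw [hvl l (by omega), hxw l (by omega)]
        exact ⟨PrefixClosed.congr hag, PrefixClosed.congr fun l hl => (hag l hl).symm⟩
    obtain ⟨σ, hσ⟩ := hoc w hwA _ (hSt hv) heq
    have hσx : ∀ k < n, x k = σ (letters w k) := fun k hk => by
      rw [← hvl k hk, hσ, letters_map σ (by omega)]
    -- Both words start with the same letter, so `σ` fixes it and is the identity on two letters,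
    -- contrary to the different last letters.
    have h0 := hσx 0 hn
    rw [hxw 0 (by omega)] at h0
    rw [hσx (n - 1) (by omega)] at hlast
    have hinj : letters w (n - 1) ≠ letters w 0 → σ (letters w (n - 1)) ≠ σ (letters w 0) :=
      fun h h' => h (σ.injective h')
    rw [← h0] at hinj
    by_cases hsame : letters w (n - 1) = letters w 0
    · exact hlast (by rw [hsame, ← h0])
    · have := hinj hsame
      cases hA : letters w (n - 1) <;> cases hB : letters w 0 <;>
        cases hC : σ (letters w (n - 1)) <;> simp_all

end OCWords

theorem mainTheorem2 : Maximal (fun A : Set (List Bool) => A ∈ OCWords.ClassC) OCWords.St :=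
  ⟨OCWords.St_mem_ClassC, fun _ hA hSt => OCWords.subset_St_of_mem_ClassC hA hSt⟩
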